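/- For a Boolean function $f:\{0,1\}^n\to\{0,1\}$ let $UQ(f)$ be its unbounded error quantum query complexity: the least number $T$ for which some quantum algorithm with a finite-dimensional state space, making $T$ queries to the black box $|i,b,w\rangle\mapsto|i,b\oplus x_i,w\rangle$, outputs $f(x)$ with probability strictly greater than $1/2$ on every input $x\in\{0,1\}^n$. There is a constant $C>0$ such that the proportion, among all $2^{2^n}$ functions $f:\{0,1\}^n\to\{0,1\}$, of those satisfying $$\frac n4\ \le\ UQ(f)\ \le\ \frac n4+C\sqrt{n\log_2 n}$$ tends to $1$ as $n\to\infty$, where for $n\equiv 1\pmod 4$ the lower bound is to be read with rounding, as $\frac{n-1}{4}\le UQ(f)$. -/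

import Mathlib

open Filter Topology

namespace QuantumQuery

/-- A total Boolean function on `n` bits. -/
abbrev BoolFun (n : ℕ) : Type := (Fin n → Bool) → Bool

/-- Computational basis `|i, b, w⟩` of a query algorithm: a query register `i` holding either the
index of an input bit or the idle value `none`, an answer bit `b`, and a workspace `w`. -/
abbrev Basis (n : ℕ) (W : Type) : Type := Option (Fin n) × Bool × W

/-- The value added to the answer bit by a query: `x i` at the index `i`, and `0` at the idle
value. -/
def queriedBit {n : ℕ} (x : Fin n → Bool) : Option (Fin n) → Bool
  | none => false
  | some i => x i

/-- The black box for the input `x`, i.e. the unitary map `|i, b, w⟩ ↦ |i, b ⊕ x_i, w⟩`, applied to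
a vector of amplitudes (the underlying permutation of the basis is an involution). -/
def applyOracle {n : ℕ} {W : Type} (x : Fin n → Bool) (ψ : Basis n W → ℂ) : Basis n W → ℂ :=
  fun s => ψ (s.1, xor s.2.1 (queriedBit x s.1), s.2.2)

/-- On basis states the black box acts as `|i, b, w⟩ ↦ |i, b ⊕ x_i, w⟩`. -/
theorem applyOracle_single {n : ℕ} {W : Type} [DecidableEq W] (x : Fin n → Bool)
    (i : Option (Fin n)) (b : Bool) (w : W) :
    applyOracle x (Pi.single ((i, b, w) : Basis n W) (1 : ℂ)) =
      Pi.single ((i, xor b (queriedBit x i), w) : Basis n W) (1 : ℂ) := by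
  funext s
  obtain ⟨j, c, v⟩ := s
  simp only [applyOracle, Pi.single_apply, Prod.mk.injEq]
  congr 1
  apply propext
  constructor
  · rintro ⟨rfl, rfl, rfl⟩
    simp
  · rintro ⟨rfl, rfl, rfl⟩
    simp

/-- A quantum query algorithm on `n` input bits with finite workspace `W`: it starts in a basis
state, applies the input-independent unitary `U 0`, then alternates `queries` black-box calls with
the unitaries `U 1, …, U queries`, measures in the computational basis, and outputs `1` exactly
when the outcome lies in `accept`. (The unitaries of larger index are never used.) -/
structure Algorithm (n : ℕ) (W : Type) [Fintype W] [DecidableEq W] where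
  queries : ℕ
  start : Basis n W
  U : ℕ → Matrix.unitaryGroup (Basis n W) ℂ
  accept : Finset (Basis n W)

namespace Algorithm

variable {n : ℕ} {W : Type} [Fintype W] [DecidableEq W]

/-- The state after `k` black-box calls (and the unitary that follows the last of them). -/
noncomputable def stateAfter (A : Algorithm n W) (x : Fin n → Bool) : ℕ → Basis n W → ℂ
  | 0 => Matrix.mulVec (A.U 0 : Matrix (Basis n W) (Basis n W) ℂ) (Pi.single A.start 1)
  | k + 1 => Matrix.mulVec (A.U (k + 1) : Matrix (Basis n W) (Basis n W) ℂ)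
      (applyOracle x (A.stateAfter x k))

/-- The probability that the measurement outcome of the final state lies in `S`. -/
noncomputable def outcomeProb (A : Algorithm n W) (x : Fin n → Bool)
    (S : Finset (Basis n W)) : ℝ :=
  ∑ s ∈ S, ‖A.stateAfter x A.queries s‖ ^ 2

/-- The probability that the algorithm outputs the bit `v` on input `x`. -/
noncomputable def outputProb (A : Algorithm n W) (x : Fin n → Bool) (v : Bool) : ℝ :=
  A.outcomeProb x (if v then A.accept else A.acceptᶜ)

/-- On every input, the correct value is output with probability greater than `1/2`. -/
def ComputesUnboundedError (A : Algorithm n W) (f : BoolFun n) : Prop :=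
  ∀ x : Fin n → Bool, 1 / 2 < A.outputProb x (f x)

end Algorithm

/-- `f` can be computed with unbounded error by some quantum algorithm making `T` queries. -/
def ComputableWith {n : ℕ} (f : BoolFun n) (T : ℕ) : Prop :=
  ∃ (W : Type) (_ : Fintype W) (_ : DecidableEq W) (A : Algorithm n W),
    A.queries = T ∧ A.ComputesUnboundedError f

/-- The unbounded error quantum query complexity of `f`: the least number of queries of a quantum
algorithm computing `f` with success probability greater than `1/2` on every input. -/
noncomputable def UQ {n : ℕ} (f : BoolFun n) : ℕ := sInf {T : ℕ | ComputableWith f T}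

/-- The proportion of the Boolean functions on `n` bits that have the property `P`. -/
noncomputable def proportion {n : ℕ} (P : BoolFun n → Prop) : ℝ :=
  (Nat.card {f : BoolFun n // P f} : ℝ) / (Nat.card (BoolFun n) : ℝ)

/-- `P` holds for almost every Boolean function: the proportion of the functions on `n` bits that
satisfy it tends to `1` as `n` tends to infinity. -/
def ForAlmostEvery (P : ∀ n : ℕ, BoolFun n → Prop) : Prop :=
  Tendsto (fun n : ℕ => proportion (P n)) atTop (𝓝 1)

end QuantumQuery

/-!
The unbounded error query complexity of `f` is governed by its threshold degree, the least degree of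
a real polynomial whose sign on the cube is `f`; here polynomials are written in the basis of
characters `χ_S(x) = (-1)^{∑_{i ∈ S} x_i}`.

If `T` queries suffice, then the bias of the output probability is a polynomial of degree at most
`2 * T` with the sign of `f` (`signRepresentable_of_computableWith`), since each query raises the
degree of the amplitudes by at most one. Conversely, let `∑ a_S χ_S` represent `f` with
`|S| ≤ 2 * T`. A character of `2 * T` bits is computed exactly by `T` queries: split `S` into two
halves, let each of two branches in superposition collect the signs of one half, and compare the
phases by a Hadamard transform. Sampling `S` with probability proportional to `|a_S|` and outputting
the sign of `a_S χ_S` gives an algorithm for `f` (`computableWith_of_signRepresentable`).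

It remains to see that the threshold degree of almost every function is at least about `n / 2` and
at most `n / 2 + O(√(n log n))`. Both follow from Hoeffding's inequality
(`card_le_sum_mul_signOf`).

* Upper bound (`card_not_signRepresentable_le`): the truncation of the Fourier expansion of `f` to
  degree `d` has the sign of `f` if the remaining tail is smaller than `1` everywhere. At a given
  point the tail is a random sign sum whose variance is the fraction of subsets `S` with `d < |S|`.
  For `d ≥ n / 2 + 2 √(n log₂ n)` this is at most `1 / n ^ 2`, so the failure probability is at most
  `2 * exp (-n ^ 2 / 2)` at each point, and a union bound over the `2 ^ n` points suffices.
* Lower bound (`card_signRepresentable_le_exp`): the sign patterns of a space of dimension `D` of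
  functions on the cube shatter no set of more than `D` points, so by the Sauer–Shelah lemma they
  number at most `#{F | |F| ≤ D}`, with `F` ranging over subsets of the cube. For `2 * d + 2 ≤ n`
  the number `D` of characters of degree at most `d` is below `2 ^ n / 2` by at least
  `2 ^ n / (2 * (n + 1))`, far more than the standard deviation of `|F|`.

The rounding of the lower bound is what `n < 4 * T + 2` says about `T` according to `n` modulo `4`.
-/

namespace QuantumQuery

open Finset

/-! ### Characters of the cube -/

/-- The sign `(-1)^b` of a bit. -/
def signOf (b : Bool) : ℝ := if b then -1 else 1

@[simp] lemma signOf_true : signOf true = -1 := rfl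

@[simp] lemma signOf_false : signOf false = 1 := rfl

@[simp] lemma signOf_mul_self (b : Bool) : signOf b * signOf b = 1 := by
  cases b <;> simp

lemma signOf_xor (b c : Bool) : signOf (xor b c) = signOf b * signOf c := by
  cases b <;> cases c <;> simp

lemma abs_signOf (b : Bool) : |signOf b| = 1 := by
  cases b <;> simp

/-- The character `χ_S(x) = (-1)^{∑_{i ∈ S} x_i}` of the cube `{0,1}^n`. -/
def character {n : ℕ} (S : Finset (Fin n)) (x : Fin n → Bool) : ℝ :=
  ∏ i ∈ S, signOf (x i)

lemma character_mul_self {n : ℕ} (S : Finset (Fin n)) (x : Fin n → Bool) :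
    character S x * character S x = 1 := by
  simp [character, ← Finset.prod_mul_distrib]

lemma character_eq_prod_univ {n : ℕ} (S : Finset (Fin n)) (x : Fin n → Bool) :
    character S x = ∏ i, if i ∈ S then signOf (x i) else 1 := by
  simp [character, Finset.prod_ite_mem]

lemma character_mul_character {n : ℕ} (S T : Finset (Fin n)) (x : Fin n → Bool) :
    character S x * character T x = character (symmDiff S T) x := by
  simp only [character_eq_prod_univ, ← Finset.prod_mul_distrib]
  refine Finset.prod_congr rfl fun i _ => ?_
  by_cases hS : i ∈ S <;> by_cases hT : i ∈ T <;> simp [Finset.mem_symmDiff, hS, hT]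

lemma sum_character_mul_character_apply {n : ℕ} (x y : Fin n → Bool) :
    ∑ S : Finset (Fin n), character S x * character S y = if x = y then 2 ^ n else 0 := by
  have h : ∑ S : Finset (Fin n), character S x * character S y
      = ∏ i, (1 + signOf (x i) * signOf (y i)) := by
    rw [Finset.prod_one_add, ← Finset.powerset_univ]
    simp [character, Finset.prod_mul_distrib]
  rw [h]
  split_ifs with hxy
  · subst hxy
    norm_num
  · obtain ⟨i, hi⟩ := Function.ne_iff.mp hxy
    refine Finset.prod_eq_zero (Finset.mem_univ i) ?_
    cases hx : x i <;> cases hy : y i <;> simp_all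

lemma sum_character {n : ℕ} (S : Finset (Fin n)) :
    ∑ y : Fin n → Bool, character S y = if S = ∅ then 2 ^ n else 0 := by
  have h : ∑ y : Fin n → Bool, character S y
      = ∏ i, ∑ b : Bool, if i ∈ S then signOf b else 1 := by
    rw [Finset.prod_univ_sum, Fintype.piFinset_univ]
    exact Finset.sum_congr rfl fun y _ => character_eq_prod_univ S y
  rw [h]
  split_ifs with hS
  · subst hS
    norm_num
  · obtain ⟨i, hi⟩ := Finset.nonempty_iff_ne_empty.mpr hS
    exact Finset.prod_eq_zero (Finset.mem_univ i) (by simp [hi])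

lemma sum_character_mul_character {n : ℕ} (S T : Finset (Fin n)) :
    ∑ y : Fin n → Bool, character S y * character T y = if S = T then 2 ^ n else 0 := by
  simp only [character_mul_character, sum_character]
  congr 1
  simp [← Finset.bot_eq_empty, symmDiff_eq_bot]

/-- `f`, with `true` encoded as the sign `-1`, is the sign of a real polynomial of degree at most `d`,
i.e. of a combination of the characters `χ_S` with `|S| ≤ d`. Strictness makes the polynomial vanish nowhere on the cube. -/
def SignRepresentable {n : ℕ} (d : ℕ) (f : BoolFun n) : Prop :=
  ∃ a : Finset (Fin n) → ℝ,
    ∀ x, 0 < signOf (f x) * ∑ S with S.card ≤ d, a S * character S x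

lemma SignRepresentable.mono {n d e : ℕ} {f : BoolFun n} (h : SignRepresentable d f)
    (hde : d ≤ e) : SignRepresentable e f := by
  obtain ⟨a, ha⟩ := h
  refine ⟨fun S => if S.card ≤ d then a S else 0, fun x => ?_⟩
  convert ha x using 2
  simp only [ite_mul, zero_mul, ← Finset.sum_filter, Finset.filter_filter]
  congr 1
  ext S
  simp only [Finset.mem_filter, Finset.mem_univ, true_and]
  omega

/-! ### Hoeffding's inequality for sign sums -/

/-- Hoeffding's inequality, as a count of sign patterns: few sign sums `∑ ± c_i` exceed `t` when
`∑ c_i ^ 2 ≤ v`. -/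
lemma card_le_sum_mul_signOf {ι : Type*} [Fintype ι] [DecidableEq ι] (c : ι → ℝ) {v t : ℝ}
    (hv : 0 < v) (hc : ∑ i, c i ^ 2 ≤ v) (ht : 0 ≤ t) :
    (#{g : ι → Bool | t ≤ ∑ i, c i * signOf (g i)} : ℝ)
      ≤ 2 ^ Fintype.card ι * Real.exp (-(t ^ 2 / (2 * v))) := by
  -- the exponent that optimises the exponential Markov inequality
  set l : ℝ := t / v with hl
  have hl0 : 0 ≤ l := div_nonneg ht hv.le
  have hmarkov : (#{g : ι → Bool | t ≤ ∑ i, c i * signOf (g i)} : ℝ) * Real.exp (l * t)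
      ≤ ∑ g : ι → Bool, Real.exp (l * ∑ i, c i * signOf (g i)) := by
    rw [← nsmul_eq_mul, ← Finset.sum_const]
    refine (Finset.sum_le_sum fun g hg => ?_).trans
      (Finset.sum_le_sum_of_subset_of_nonneg (Finset.filter_subset _ _)
        fun _ _ _ => (Real.exp_pos _).le)
    have := (Finset.mem_filter.mp hg).2
    gcongr
  have hmoment : ∑ g : ι → Bool, Real.exp (l * ∑ i, c i * signOf (g i))
      ≤ 2 ^ Fintype.card ι * Real.exp (l ^ 2 * v / 2) := by
    calc ∑ g : ι → Bool, Real.exp (l * ∑ i, c i * signOf (g i))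
        = ∏ i, ∑ b : Bool, Real.exp (l * c i * signOf b) := by
          rw [Finset.prod_univ_sum, Fintype.piFinset_univ]
          refine Finset.sum_congr rfl fun g _ => ?_
          rw [← Real.exp_sum, Finset.mul_sum]
          simp [mul_assoc]
      _ = ∏ i, 2 * Real.cosh (l * c i) := by
          refine Finset.prod_congr rfl fun i _ => ?_
          rw [Real.cosh_eq, Fintype.sum_bool]
          simp
          ring
      _ ≤ ∏ i, 2 * Real.exp ((l * c i) ^ 2 / 2) := by
          refine Finset.prod_le_prod (fun i _ => by positivity) fun i _ => ?_
          gcongr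
          exact Real.cosh_le_exp_half_sq _
      _ = 2 ^ Fintype.card ι * Real.exp (l ^ 2 * (∑ i, c i ^ 2) / 2) := by
          rw [Finset.prod_mul_distrib, ← Real.exp_sum, Finset.mul_sum, Finset.sum_div]
          simp [mul_pow]
      _ ≤ _ := by gcongr
  have h := hmarkov.trans hmoment
  rw [← le_div_iff₀ (Real.exp_pos _), mul_div_assoc, ← Real.exp_sub] at h
  have hexp : l ^ 2 * v / 2 - l * t = -(t ^ 2 / (2 * v)) := by
    rw [hl]
    field_simp
    ring
  rwa [hexp] at h

lemma sum_signOf_decide_mem {ι : Type*} [Fintype ι] [DecidableEq ι] (S : Finset ι) :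
    ∑ i, signOf (decide (i ∈ S)) = Fintype.card ι - 2 * S.card := by
  have h : ∀ i, signOf (decide (i ∈ S)) = 1 - 2 * (if i ∈ S then 1 else 0) := by
    intro i
    by_cases hi : i ∈ S <;> simp [hi]
    norm_num
  simp [h, Finset.sum_sub_distrib, mul_comm]

/-- The equivalence between subsets and their Boolean indicator functions. -/
def indicatorEquiv (ι : Type*) [Fintype ι] [DecidableEq ι] : Finset ι ≃ (ι → Bool) where
  toFun S i := decide (i ∈ S)
  invFun g := {i | g i = true}
  left_inv S := by ext; simp
  right_inv g := by ext; simp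

/-- Hoeffding's inequality for the size of a random subset; `e = 1` gives the upper tail and `e = -1`
the lower one. -/
lemma card_finset_filter_le {ι : Type*} [Fintype ι] [DecidableEq ι] {v t e : ℝ}
    (hv : 0 < v) (he : e ^ 2 = 1) (hc : (Fintype.card ι : ℝ) ≤ v) (ht : 0 ≤ t) :
    (#{S : Finset ι | t ≤ e * (2 * (#S : ℝ) - Fintype.card ι)} : ℝ)
      ≤ 2 ^ Fintype.card ι * Real.exp (-(t ^ 2 / (2 * v))) := by
  refine le_trans (le_of_eq ?_) (card_le_sum_mul_signOf (fun _ : ι => -e) hv (by simpa [he]) ht)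
  congr 1
  refine Finset.card_equiv (indicatorEquiv ι) fun S => ?_
  simp only [Finset.mem_filter, Finset.mem_univ, true_and, ← Finset.mul_sum, indicatorEquiv,
    Equiv.coe_fn_mk, sum_signOf_decide_mem]
  ring_nf

/-! ### Most functions have threshold degree at most `n / 2 + O(√(n log n))` -/

/-- Fourier truncation represents the sign of `f` as soon as the discarded tail is smaller than `1`
in absolute value; at each point the tail is a sign sum in the values of `f`, whose coefficients
have square sum `#{S | d < |S|} / 2 ^ n` by orthogonality. -/
lemma card_not_signRepresentable_le {n d : ℕ} {v : ℝ} (hv : 0 < v)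
    (hd : (#{S : Finset (Fin n) | d < #S} : ℝ) ≤ v * 2 ^ n) :
    (Nat.card {f : BoolFun n // ¬ SignRepresentable d f} : ℝ)
      ≤ 2 ^ (n + 1) * (2 ^ 2 ^ n * Real.exp (-(1 / (2 * v)))) := by
  classical
  -- `c x y` is the coefficient of the value at `y` in the tail at `x`
  let c : (Fin n → Bool) → (Fin n → Bool) → ℝ := fun x y =>
    (2 ^ n)⁻¹ * ∑ S with d < #S, character S x * character S y
  have hc : ∀ x, ∑ y, c x y ^ 2 ≤ v := by
    intro x
    have h : ∑ y, c x y ^ 2 = (2 ^ n)⁻¹ * #{S : Finset (Fin n) | d < #S} := by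
      calc ∑ y, c x y ^ 2
          = ((2 ^ n)⁻¹) ^ 2 * ∑ y, ∑ S with d < #S, ∑ T with d < #T,
              character S x * character T x * (character S y * character T y) := by
            simp only [c, mul_pow]
            rw [← Finset.mul_sum]
            simp only [sq, Finset.sum_mul_sum]
            refine congrArg _ (Finset.sum_congr rfl fun y _ => Finset.sum_congr rfl fun S _ =>
              Finset.sum_congr rfl fun T _ => ?_)
            ring
        _ = ((2 ^ n)⁻¹) ^ 2 * ∑ S : Finset (Fin n) with d < #S, ∑ T with d < #T,
              character S x * character T x * (if S = T then 2 ^ n else 0) := by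
            rw [Finset.sum_comm]
            congr! 2
            rw [Finset.sum_comm]
            simp only [← Finset.mul_sum, sum_character_mul_character]
        _ = ((2 ^ n)⁻¹) ^ 2 * ∑ S : Finset (Fin n) with d < #S, 2 ^ n := by
            congr 1
            refine Finset.sum_congr rfl fun S hS => ?_
            simp only [mul_ite, mul_zero, Finset.sum_ite_eq, hS, if_true, character_mul_self,
              one_mul]
        _ = _ := by
            rw [Finset.sum_const, nsmul_eq_mul]
            field_simp
    rw [h, inv_mul_le_iff₀ (by positivity), mul_comm]
    exact hd
  have hsub : ∀ f : BoolFun n, ¬ SignRepresentable d f →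
      ∃ p : (Fin n → Bool) × Bool, 1 ≤ ∑ y, (signOf p.2 * c p.1 y) * signOf (f y) := by
    intro f hf
    by_contra! hsmall
    refine hf ⟨fun S => (2 ^ n)⁻¹ * ∑ y, signOf (f y) * character S y, fun x => ?_⟩
    have htail : ∀ x, ∑ S with #S ≤ d, ((2 ^ n)⁻¹ * ∑ y, signOf (f y) * character S y) *
        character S x = signOf (f x) - ∑ y, c x y * signOf (f y) := by
      intro x
      have hinv : ∑ S, ((2 ^ n)⁻¹ * ∑ y, signOf (f y) * character S y) * character S x
          = signOf (f x) := by
        calc _ = (2 ^ n)⁻¹ * ∑ y, signOf (f y) * ∑ S, character S x * character S y := by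
              simp only [Finset.mul_sum, Finset.sum_mul]
              rw [Finset.sum_comm]
              refine Finset.sum_congr rfl fun y _ => Finset.sum_congr rfl fun S _ => ?_
              ring
          _ = _ := by
              simp only [sum_character_mul_character_apply, mul_ite, mul_zero, Finset.sum_ite_eq,
                Finset.mem_univ, if_true]
              field_simp
      have hhigh : ∑ y, c x y * signOf (f y) = ∑ S with ¬ #S ≤ d,
          ((2 ^ n)⁻¹ * ∑ y, signOf (f y) * character S y) * character S x := by
        simp only [c, not_le, Finset.mul_sum, Finset.sum_mul]
        rw [Finset.sum_comm]
        refine Finset.sum_congr rfl fun S _ => Finset.sum_congr rfl fun y _ => ?_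
        ring
      rw [hhigh, ← hinv, eq_sub_iff_add_eq, Finset.sum_filter_add_sum_filter_not]
    rw [htail]
    have h := hsmall (x, f x)
    simp only [mul_assoc] at h
    rw [← Finset.mul_sum] at h
    rw [mul_sub, signOf_mul_self]
    linarith
  have hcard : Nat.card {f : BoolFun n // ¬ SignRepresentable d f}
      ≤ ∑ p : (Fin n → Bool) × Bool,
        #{f : BoolFun n | 1 ≤ ∑ y, (signOf p.2 * c p.1 y) * signOf (f y)} := by
    rw [Nat.card_eq_fintype_card, Fintype.card_subtype]
    refine (Finset.card_le_card fun f hf => ?_).trans Finset.card_biUnion_le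
    obtain ⟨p, hp⟩ := hsub f (Finset.mem_filter.mp hf).2
    simp only [Finset.mem_biUnion, Finset.mem_filter, Finset.mem_univ, true_and]
    exact ⟨p, hp⟩
  calc (Nat.card {f : BoolFun n // ¬ SignRepresentable d f} : ℝ)
      ≤ ∑ p : (Fin n → Bool) × Bool,
        (#{f : BoolFun n | 1 ≤ ∑ y, (signOf p.2 * c p.1 y) * signOf (f y)} : ℝ) := by
        exact_mod_cast hcard
    _ ≤ ∑ p : (Fin n → Bool) × Bool, (2 ^ 2 ^ n * Real.exp (-(1 / (2 * v)))) := by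
        refine Finset.sum_le_sum fun p _ => ?_
        refine (card_le_sum_mul_signOf _ hv ?_ zero_le_one).trans (by simp)
        refine le_trans (le_of_eq (Finset.sum_congr rfl fun y _ => ?_)) (hc p.1)
        rw [mul_pow, sq (signOf p.2), signOf_mul_self, one_mul]
    _ = _ := by
        simp [pow_succ]

/-! ### Most functions have threshold degree at least `n / 2` -/

/-- The sets of negative points of sign-representable functions shatter no set larger than the
number of available characters: a linear relation among the evaluations at the points of a larger
set excludes the sign pattern of its coefficients. -/
lemma card_le_of_shatters {n d : ℕ} {𝒜 : Finset (Finset (Fin n → Bool))}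
    (h𝒜 : ∀ F ∈ 𝒜, SignRepresentable d fun x => decide (x ∈ F)) {X : Finset (Fin n → Bool)}
    (hX : 𝒜.Shatters X) : #X ≤ #{S : Finset (Fin n) | #S ≤ d} := by
  classical
  by_contra! hlt
  let L : (X → ℝ) →ₗ[ℝ] ({S : Finset (Fin n) // #S ≤ d} → ℝ) :=
    { toFun := fun l S => ∑ x : X, l x * character S.1 x.1
      map_add' := fun l m => by ext; simp [add_mul, Finset.sum_add_distrib]
      map_smul' := fun r l => by ext; simp [Finset.mul_sum, mul_assoc] }
  have hker : LinearMap.ker L ≠ ⊥ := by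
    apply LinearMap.ker_ne_bot_of_finrank_lt
    simpa [Fintype.card_subtype] using hlt
  obtain ⟨l, hl, hl0⟩ := (Submodule.ne_bot_iff _).mp hker
  obtain ⟨x₀, hx₀⟩ := Function.ne_iff.mp hl0
  obtain ⟨F, hF, hFX⟩ := hX (Finset.filter_subset
    (fun x => ∃ h : x ∈ X, l ⟨x, h⟩ < 0) X)
  have hmem : ∀ x : X, x.1 ∈ F ↔ l x < 0 := by
    intro x
    have := congrArg (x.1 ∈ ·) hFX
    simpa [x.2] using this
  obtain ⟨a, ha⟩ := h𝒜 F hF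
  have hzero : ∑ x : X, l x * ∑ S with #S ≤ d, a S * character S x.1 = 0 := by
    calc _ = ∑ S with #S ≤ d, a S * ∑ x : X, l x * character S x.1 := by
          simp only [Finset.mul_sum]
          rw [Finset.sum_comm]
          congr! 2
          ring
      _ = 0 := by
          refine Finset.sum_eq_zero fun S hS => ?_
          have := congrFun (LinearMap.mem_ker.mp hl) ⟨S, (Finset.mem_filter.mp hS).2⟩
          simp only [L, LinearMap.coe_mk, AddHom.coe_mk, Pi.zero_apply] at this
          rw [this, mul_zero]
  have hpos : ∀ x : X, l x ≠ 0 → 0 < l x * ∑ S with #S ≤ d, a S * character S x.1 := by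
    intro x hx
    have h := ha x.1
    rcases lt_or_gt_of_ne hx with hx | hx
    · simp only [(hmem x).mpr hx, decide_true, signOf_true] at h
      exact mul_pos_of_neg_of_neg hx (by linarith)
    · have hn : x.1 ∉ F := fun hxF => absurd ((hmem x).mp hxF) hx.not_gt
      simp only [hn, decide_false, signOf_false, one_mul] at h
      exact mul_pos hx h
  refine hzero.not_gt (Finset.sum_pos' (fun x _ => ?_) ⟨x₀, Finset.mem_univ _, hpos x₀ hx₀⟩)
  by_cases hx : l x = 0
  · simp [hx]
  · exact (hpos x hx).le

/-- The Sauer–Shelah bound on the number of sign-representable functions. -/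
lemma card_signRepresentable_le (n d : ℕ) :
    Nat.card {f : BoolFun n // SignRepresentable d f}
      ≤ #{F : Finset (Fin n → Bool) | #F ≤ #{S : Finset (Fin n) | #S ≤ d}} := by
  classical
  let 𝒜 : Finset (Finset (Fin n → Bool)) := {F | SignRepresentable d fun x => decide (x ∈ F)}
  have hcard : Nat.card {f : BoolFun n // SignRepresentable d f} = #𝒜 := by
    rw [Nat.card_eq_fintype_card, Fintype.card_subtype]
    refine (Finset.card_equiv (indicatorEquiv _) fun F => ?_).symm
    simp [𝒜, indicatorEquiv]
  rw [hcard]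
  refine 𝒜.card_le_card_shatterer.trans (Finset.card_le_card fun X hX => ?_)
  simp only [Finset.mem_filter, Finset.mem_univ, true_and]
  exact card_le_of_shatters (fun F hF => (Finset.mem_filter.mp hF).2)
    (Finset.mem_shatterer.mp hX)

/-- Below the middle layer there are fewer than half of all subsets, by a margin of a fraction
`1 / (n + 1)`. -/
lemma card_filter_card_le_add {n d : ℕ} (h : 2 * d + 2 ≤ n) :
    2 * (#{S : Finset (Fin n) | #S ≤ d} : ℝ) + 2 ^ n / (n + 1) ≤ 2 ^ n := by
  classical
  have hcompl : #{S : Finset (Fin n) | n ≤ #S + d} = #{S : Finset (Fin n) | #S ≤ d} := by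
    refine Finset.card_equiv (compl_involutive.toPerm _) fun S => ?_
    have := S.card_le_univ
    simp [Finset.card_compl, Function.Involutive.coe_toPerm] at this ⊢
    omega
  have hmid : #{S : Finset (Fin n) | #S = n / 2} = n.choose (n / 2) := by
    rw [← Finset.powerset_univ, ← Finset.powersetCard_eq_filter, Finset.card_powersetCard,
      Finset.card_univ, Fintype.card_fin]
  have hdisj : #{S : Finset (Fin n) | #S ≤ d} + #{S : Finset (Fin n) | n ≤ #S + d}
      + #{S : Finset (Fin n) | #S = n / 2} ≤ 2 ^ n := by
    rw [← Finset.card_union_of_disjoint, ← Finset.card_union_of_disjoint]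
    · exact (Finset.card_le_univ _).trans (by simp)
    all_goals
      simp only [Finset.disjoint_left, Finset.mem_union, Finset.mem_filter, Finset.mem_univ,
        true_and]
      intro S hS
      omega
  have hbig : 2 ^ n ≤ (n + 1) * n.choose (n / 2) := by
    rw [← Nat.sum_range_choose]
    refine (Finset.sum_le_card_nsmul _ _ _ fun k _ => Nat.choose_le_middle k n).trans (by simp)
  rw [hcompl, hmid] at hdisj
  have h1 : (2 : ℝ) ^ n / (n + 1) ≤ n.choose (n / 2) := by
    rw [div_le_iff₀' (by positivity)]
    exact_mod_cast hbig
  have h2 : 2 * (#{S : Finset (Fin n) | #S ≤ d} : ℝ) + n.choose (n / 2) ≤ 2 ^ n := by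
    rw [two_mul]
    exact_mod_cast hdisj
  linarith

lemma card_signRepresentable_le_exp {n d : ℕ} (h : 2 * d + 2 ≤ n) :
    (Nat.card {f : BoolFun n // SignRepresentable d f} : ℝ)
      ≤ 2 ^ 2 ^ n * Real.exp (-(2 ^ n / (2 * (n + 1) ^ 2))) := by
  have hN : (Fintype.card (Fin n → Bool) : ℝ) = 2 ^ n := by simp
  have hsmall := card_finset_filter_le (ι := Fin n → Bool) (v := 2 ^ n) (t := 2 ^ n / (n + 1))
    (e := -1) (by positivity) (by norm_num) hN.le (by positivity)
  calc (Nat.card {f : BoolFun n // SignRepresentable d f} : ℝ)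
      ≤ #{F : Finset (Fin n → Bool) | #F ≤ #{S : Finset (Fin n) | #S ≤ d}} := by
        exact_mod_cast card_signRepresentable_le n d
    _ ≤ _ := by
        refine le_trans ?_ hsmall
        refine Nat.cast_le.mpr (Finset.card_le_card fun F hF => ?_)
        simp only [Finset.mem_filter, Finset.mem_univ, true_and] at hF ⊢
        have h1 := card_filter_card_le_add h
        have h2 : (#F : ℝ) ≤ #{S : Finset (Fin n) | #S ≤ d} := by exact_mod_cast hF
        rw [hN]
        linarith
    _ = _ := by
        have : Fintype.card (Fin n → Bool) = 2 ^ n := by simp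
        rw [this]
        congr 3
        field_simp

/-! ### Unitary matrices -/

lemma sum_norm_sq_mulVec {ι : Type*} [Fintype ι] [DecidableEq ι] (U : Matrix.unitaryGroup ι ℂ)
    (ψ : ι → ℂ) : ∑ s, ‖(U : Matrix ι ι ℂ).mulVec ψ s‖ ^ 2 = ∑ s, ‖ψ s‖ ^ 2 := by
  have h : ∀ φ : ι → ℂ, ((∑ s, ‖φ s‖ ^ 2 : ℝ) : ℂ) = dotProduct (star φ) φ := by
    intro φ
    simp [dotProduct, Complex.conj_mul']
  have hU : (U : Matrix ι ι ℂ).conjTranspose * (U : Matrix ι ι ℂ) = 1 :=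
    Matrix.mem_unitaryGroup_iff'.mp U.2
  apply Complex.ofReal_injective
  rw [h, h, Matrix.star_mulVec, Matrix.dotProduct_mulVec, Matrix.vecMul_vecMul, hU,
    Matrix.vecMul_one]

lemma exists_unitary_of_sum_norm_sq_eq {ι : Type*} [Fintype ι] [DecidableEq ι]
    (L : (ι → ℂ) →ₗ[ℂ] (ι → ℂ)) (hL : ∀ ψ, ∑ s, ‖L ψ s‖ ^ 2 = ∑ s, ‖ψ s‖ ^ 2) :
    ∃ U : Matrix.unitaryGroup ι ℂ, ∀ ψ, (U : Matrix ι ι ℂ).mulVec ψ = L ψ := by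
  let L' : EuclideanSpace ℂ ι →ₗᵢ[ℂ] EuclideanSpace ℂ ι :=
    { toLinearMap := (WithLp.linearEquiv 2 ℂ (ι → ℂ)).symm.toLinearMap ∘ₗ L ∘ₗ
        (WithLp.linearEquiv 2 ℂ (ι → ℂ)).toLinearMap
      norm_map' := fun ψ => by
        rw [EuclideanSpace.norm_eq, EuclideanSpace.norm_eq]
        exact congrArg Real.sqrt (hL ψ.ofLp) }
  let b := EuclideanSpace.basisFun ι ℂ
  refine ⟨⟨_, (L'.toLinearIsometryEquiv rfl).toMatrix_mem_unitaryGroup b b⟩, fun ψ => ?_⟩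
  have h := LinearMap.toMatrix_mulVec_repr b.toBasis b.toBasis
    (L'.toLinearIsometryEquiv rfl).toLinearEquiv.toLinearMap (WithLp.toLp 2 ψ)
  ext s
  exact congrFun h s

lemma exists_unitary_mulVec_single {ι : Type*} [Fintype ι] [DecidableEq ι] (s₀ : ι) (ψ : ι → ℂ)
    (hψ : ∑ s, ‖ψ s‖ ^ 2 = 1) :
    ∃ U : Matrix.unitaryGroup ι ℂ, (U : Matrix ι ι ℂ).mulVec (Pi.single s₀ 1) = ψ := by
  have hnorm : ‖(WithLp.toLp 2 ψ : EuclideanSpace ℂ ι)‖ = 1 := by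
    rw [EuclideanSpace.norm_eq, Real.sqrt_eq_one]
    exact hψ
  obtain ⟨b, hb⟩ := Orthonormal.exists_orthonormalBasis_extension_of_card_eq (𝕜 := ℂ)
    (E := EuclideanSpace ℂ ι) (v := fun _ => WithLp.toLp 2 ψ) (s := {s₀}) (by simp)
    ⟨fun _ => hnorm, fun i j hij => absurd (Subsingleton.elim i j) hij⟩
  refine ⟨⟨_, (EuclideanSpace.basisFun ι ℂ).toMatrix_orthonormalBasis_mem_unitary b⟩, ?_⟩
  ext s
  simp [Module.Basis.toMatrix_apply, hb s₀ rfl]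

/-! ### Acceptance probabilities as polynomials -/

/-- The complex functions on the cube of degree at most `d`. -/
def degreeLE (n d : ℕ) : Submodule ℂ ((Fin n → Bool) → ℂ) :=
  Submodule.span ℂ ((fun S x => (character S x : ℂ)) '' {S : Finset (Fin n) | #S ≤ d})

lemma character_mem_degreeLE {n d : ℕ} {S : Finset (Fin n)} (hS : #S ≤ d) :
    (fun x => (character S x : ℂ)) ∈ degreeLE n d :=
  Submodule.subset_span ⟨S, hS, rfl⟩

lemma degreeLE_mono {n d e : ℕ} (h : d ≤ e) : degreeLE n d ≤ degreeLE n e :=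
  Submodule.span_mono (Set.image_mono fun _ hS => le_trans hS h)

lemma mul_mem_degreeLE {n d e : ℕ} {g h : (Fin n → Bool) → ℂ} (hg : g ∈ degreeLE n d)
    (hh : h ∈ degreeLE n e) : g * h ∈ degreeLE n (d + e) := by
  have hmul := Submodule.mul_mem_mul hg hh
  rw [degreeLE, degreeLE, Submodule.span_mul_span] at hmul
  refine Submodule.span_le.mpr ?_ hmul
  rintro _ ⟨_, ⟨S, hS, rfl⟩, _, ⟨T, hT, rfl⟩, rfl⟩
  have hcard : #(symmDiff S T) ≤ d + e :=
    (Finset.card_le_card (symmDiff_le_sup (a := S) (b := T))).trans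
      ((Finset.card_union_le S T).trans (add_le_add hS hT))
  have heq : ((fun x => (character S x : ℂ)) * fun x => (character T x : ℂ))
      = fun x => (character (symmDiff S T) x : ℂ) := by
    ext x
    simp [← character_mul_character]
  change _ * _ ∈ degreeLE n (d + e)
  rw [heq]
  exact character_mem_degreeLE hcard

lemma star_mem_degreeLE {n d : ℕ} {g : (Fin n → Bool) → ℂ} (hg : g ∈ degreeLE n d) :
    star g ∈ degreeLE n d := by
  induction hg using Submodule.span_induction with
  | mem g hg =>
    obtain ⟨S, hS, rfl⟩ := hg
    convert character_mem_degreeLE hS using 1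
    ext x
    simp
  | zero => simp
  | add g h _ _ hg hh => simpa using add_mem hg hh
  | smul r g _ hg => simpa using Submodule.smul_mem _ (star r) hg

lemma exists_real_coefficients {n d : ℕ} {p : (Fin n → Bool) → ℝ}
    (hp : (fun x => (p x : ℂ)) ∈ degreeLE n d) :
    ∃ a : Finset (Fin n) → ℝ, ∀ x, p x = ∑ S with #S ≤ d, a S * character S x := by
  have hset : {S : Finset (Fin n) | #S ≤ d}
      = ((Finset.univ.filter fun S : Finset (Fin n) => #S ≤ d : Finset _) : Set _) := by
    ext
    simp
  rw [degreeLE, hset, Submodule.mem_span_image_finset_iff_exists_fun'] at hp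
  obtain ⟨a, ha⟩ := hp
  refine ⟨fun S => (a S).re, fun x => ?_⟩
  have h := congrArg Complex.re (congrFun ha x)
  simpa using h.symm

lemma sum_norm_sq_applyOracle {n : ℕ} {W : Type} [Fintype W] (x : Fin n → Bool) (ψ : Basis n W → ℂ) :
    ∑ s, ‖applyOracle x ψ s‖ ^ 2 = ∑ s, ‖ψ s‖ ^ 2 := by
  have hinv : Function.Involutive
      fun s : Basis n W => (s.1, xor s.2.1 (queriedBit x s.1), s.2.2) := by
    intro s
    simp
  exact Equiv.sum_comp hinv.toPerm fun s => ‖ψ s‖ ^ 2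

lemma applyOracle_mem_degreeLE {n k : ℕ} {W : Type} {ψ : (Fin n → Bool) → Basis n W → ℂ}
    (hψ : ∀ s, (fun x => ψ x s) ∈ degreeLE n k) (s : Basis n W) :
    (fun x => applyOracle x (ψ x) s) ∈ degreeLE n (k + 1) := by
  obtain ⟨i, b, w⟩ := s
  cases i with
  | none =>
    simpa [applyOracle, queriedBit] using degreeLE_mono (Nat.le_succ k) (hψ (none, b, w))
  | some i =>
    -- the answer bit is flipped or not according to the sign of `x i`
    have h : (fun x => applyOracle x (ψ x) (some i, b, w))
        = (1 / 2 : ℂ) • ((fun x => ψ x (some i, b, w)) + fun x => ψ x (some i, !b, w))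
          + (1 / 2 : ℂ) • (((fun x => ψ x (some i, b, w)) - fun x => ψ x (some i, !b, w))
            * fun x => (character {i} x : ℂ)) := by
      ext x
      cases hx : x i <;> simp [applyOracle, queriedBit, character, hx] <;> ring
    rw [h]
    exact add_mem
      (Submodule.smul_mem _ _ (degreeLE_mono (Nat.le_succ k) (add_mem (hψ _) (hψ _))))
      (Submodule.smul_mem _ _ (mul_mem_degreeLE (sub_mem (hψ _) (hψ _))
        (character_mem_degreeLE (by simp))))

namespace Algorithm

variable {n : ℕ} {W : Type} [Fintype W] [DecidableEq W]

lemma sum_norm_sq_stateAfter (A : Algorithm n W) (x : Fin n → Bool) (k : ℕ) :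
    ∑ s, ‖A.stateAfter x k s‖ ^ 2 = 1 := by
  induction k with
  | zero =>
    rw [stateAfter, sum_norm_sq_mulVec]
    simp [Pi.single_apply, apply_ite]
  | succ k ih => rw [stateAfter, sum_norm_sq_mulVec, sum_norm_sq_applyOracle, ih]

lemma outputProb_add_not (A : Algorithm n W) (x : Fin n → Bool) (v : Bool) :
    A.outputProb x v + A.outputProb x (!v) = 1 := by
  have h := Finset.sum_add_sum_compl A.accept fun s => ‖A.stateAfter x A.queries s‖ ^ 2
  rw [A.sum_norm_sq_stateAfter x A.queries] at h
  cases v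
  · rw [← h, add_comm]
    rfl
  · exact h

/-- Each query raises the degree of the amplitudes, as functions of the input, by at most one. -/
lemma stateAfter_mem_degreeLE (A : Algorithm n W) (k : ℕ) (s : Basis n W) :
    (fun x => A.stateAfter x k s) ∈ degreeLE n k := by
  induction k generalizing s with
  | zero =>
    simp only [stateAfter]
    convert Submodule.smul_mem _ (Matrix.mulVec (A.U 0 : Matrix (Basis n W) (Basis n W) ℂ)
      (Pi.single A.start 1) s) (character_mem_degreeLE (n := n) (d := 0) (S := ∅) le_rfl) using 1
    funext x
    simp [character]
  | succ k ih =>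
    have h : (fun x => A.stateAfter x (k + 1) s)
        = ∑ s', (A.U (k + 1) : Matrix (Basis n W) (Basis n W) ℂ) s s' •
          fun x => applyOracle x (A.stateAfter x k) s' := by
      ext x
      simp [stateAfter, Matrix.mulVec, dotProduct]
    rw [h]
    exact sum_mem fun s' _ => Submodule.smul_mem _ _ (applyOracle_mem_degreeLE ih s')

lemma outputProb_mem_degreeLE (A : Algorithm n W) (v : Bool) :
    (fun x => (A.outputProb x v : ℂ)) ∈ degreeLE n (2 * A.queries) := by
  have h : (fun x => (A.outputProb x v : ℂ)) = ∑ s ∈ if v then A.accept else A.acceptᶜ,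
      (star fun x => A.stateAfter x A.queries s) * fun x => A.stateAfter x A.queries s := by
    ext x
    simp [outputProb, outcomeProb, Complex.conj_mul']
  rw [h, two_mul]
  exact sum_mem fun s _ => mul_mem_degreeLE (star_mem_degreeLE (A.stateAfter_mem_degreeLE _ s))
    (A.stateAfter_mem_degreeLE _ s)

end Algorithm

lemma signRepresentable_of_computableWith {n T : ℕ} {f : BoolFun n} (h : ComputableWith f T) :
    SignRepresentable (2 * T) f := by
  obtain ⟨W, _, _, A, rfl, hA⟩ := h
  obtain ⟨a, ha⟩ := exists_real_coefficients
    (p := fun x => A.outputProb x false - A.outputProb x true) (d := 2 * A.queries) (by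
      convert sub_mem (A.outputProb_mem_degreeLE false) (A.outputProb_mem_degreeLE true) using 1
      ext x
      simp)
  refine ⟨a, fun x => ?_⟩
  rw [← ha x]
  have h1 := hA x
  have h2 := A.outputProb_add_not x (f x)
  cases hf : f x <;> simp only [hf, Bool.not_false, Bool.not_true] at h1 h2 <;> simp <;> linarith

/-! ### An algorithm sampling a character -/

lemma prod_range_getElem? {α : Type*} (l : List α) (g : Option α → ℝ) (hg : g none = 1) {T : ℕ}
    (hl : l.length ≤ T) : ∏ j ∈ range T, g l[j]? = (l.map fun a => g (some a)).prod := by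
  induction l generalizing T with
  | nil => simp [hg]
  | cons a l ih =>
    obtain ⟨T, rfl⟩ : ∃ T', T = T' + 1 := ⟨T - 1, by simp at hl; omega⟩
    rw [Finset.prod_range_succ']
    simp only [List.getElem?_cons_succ, List.getElem?_cons_zero, List.map_cons, List.prod_cons]
    rw [ih (by simpa using hl), mul_comm]

/-- A set of at most `2 * T` indices is enumerated by two query sequences of length `T`, padded with
idle queries. -/
lemma exists_query_sequences {n T : ℕ} (S : Finset (Fin n)) (hS : #S ≤ 2 * T) :
    ∃ e : Bool → ℕ → Option (Fin n), (∀ q, e q T = none) ∧ ∀ x,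
      (∏ j ∈ range T, signOf (queriedBit x (e false j))) *
        ∏ j ∈ range T, signOf (queriedBit x (e true j)) = character S x := by
  have h0 : (S.toList.take T).length ≤ T := by simp
  have h1 : (S.toList.drop T).length ≤ T := by
    simp
    omega
  refine ⟨fun q j => if q then (S.toList.drop T)[j]? else (S.toList.take T)[j]?, ?_, fun x => ?_⟩
  · rintro (_ | _)
    · exact List.getElem?_eq_none h0
    · exact List.getElem?_eq_none h1
  · simp only [if_true, Bool.false_eq_true, if_false]
    rw [prod_range_getElem? _ (fun o => signOf (queriedBit x o)) rfl h0,
      prod_range_getElem? _ (fun o => signOf (queriedBit x o)) rfl h1, ← List.prod_append,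
      ← List.map_append, List.take_append_drop, Finset.prod_map_toList]
    rfl

/-- If the state evolves as `φ` under the oracle and the unitaries `V k`, then some algorithm
reaches `H (φ T)` after `T` queries, whatever the unitary `H`. -/
lemma exists_algorithm_of_evolution {n : ℕ} {W : Type} [Fintype W] [DecidableEq W] (T : ℕ)
    (start : Basis n W) (V : ℕ → Matrix.unitaryGroup (Basis n W) ℂ)
    (H : Matrix.unitaryGroup (Basis n W) ℂ) (accept : Finset (Basis n W))
    (φ : (Fin n → Bool) → ℕ → Basis n W → ℂ)
    (h0 : ∀ x, (V 0 : Matrix (Basis n W) (Basis n W) ℂ).mulVec (Pi.single start 1) = φ x 0)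
    (hstep : ∀ x k, (V (k + 1) : Matrix (Basis n W) (Basis n W) ℂ).mulVec (applyOracle x (φ x k))
      = φ x (k + 1)) :
    ∃ A : Algorithm n W, A.queries = T ∧ A.accept = accept ∧ ∀ x,
      A.stateAfter x T = (H : Matrix (Basis n W) (Basis n W) ℂ).mulVec (φ x T) := by
  let A : Algorithm n W := ⟨T, start, fun k => if k = T then H * V k else V k, accept⟩
  have hA : ∀ x k, k ≤ T → A.stateAfter x k
      = if k = T then (H : Matrix (Basis n W) (Basis n W) ℂ).mulVec (φ x k) else φ x k := by
    intro x k hk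
    induction k with
    | zero =>
      rw [Algorithm.stateAfter, ← h0]
      simp only [A]
      split_ifs
      · rw [Matrix.mulVec_mulVec]
        rfl
      · rfl
    | succ k ih =>
      rw [Algorithm.stateAfter, ih (by omega), if_neg (by omega), ← hstep]
      simp only [A]
      split_ifs <;> simp
  exact ⟨A, rfl, rfl, fun x => by rw [hA x T le_rfl, if_pos rfl]⟩

/-- A register `m` in superposition with amplitudes `c m` controls two branches `q`, in which the
sequences of indices `e m q` are queried. With the answer bit in the state `|0⟩ - |1⟩`, each query
contributes a sign; after a Hadamard transform of `q`, the bit `q` is biased by the product of the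
signs of both branches. The output is `q`, negated when `neg m` holds. -/
lemma exists_algorithm_outputProb_eq {n T : ℕ} {ι : Type} [Fintype ι] [DecidableEq ι]
    (e : ι → Bool → ℕ → Option (Fin n)) (he : ∀ m q, e m q T = none) (c : ι → ℝ)
    (hc : ∑ m, c m ^ 2 = 1) (neg : ι → Bool) :
    ∃ A : Algorithm n (ι × Bool), A.queries = T ∧ ∀ x v,
      A.outputProb x v = ∑ m, c m ^ 2 / 2 * (1 + signOf v * signOf (neg m) *
        ((∏ j ∈ range T, signOf (queriedBit x (e m false j))) *
          ∏ j ∈ range T, signOf (queriedBit x (e m true j)))) := by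
  classical
  -- the phase collected in branch `q` by the first `k` queries
  let P : (Fin n → Bool) → ι → Bool → ℕ → ℝ := fun x m q k =>
    ∏ j ∈ range k, signOf (queriedBit x (e m q j))
  have hP : ∀ x m q k, P x m q k * P x m q k = 1 := by
    intro x m q k
    simp [P, ← Finset.prod_mul_distrib]
  let φ : (Fin n → Bool) → ℕ → Basis n (ι × Bool) → ℂ := fun x k s =>
    if s.1 = e s.2.2.1 s.2.2.2 k then
      ((signOf s.2.1 * (c s.2.2.1 / 2) * P x s.2.2.1 s.2.2.2 k : ℝ) : ℂ) else 0
  obtain ⟨m₀⟩ : Nonempty ι := by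
    by_contra hι
    rw [not_nonempty_iff] at hι
    simp at hc
  let start : Basis n (ι × Bool) := (none, false, m₀, false)
  have hφ0 : ∀ x y, φ x 0 = φ y 0 := fun x y => by simp [φ, P]
  have hφnorm : ∑ s, ‖φ (fun _ => false) 0 s‖ ^ 2 = 1 := by
    rw [Fintype.sum_prod_type_right]
    simp only [φ, P, Finset.range_zero, Finset.prod_empty, mul_one, apply_ite, norm_zero, ite_pow,
      Finset.sum_ite_eq', Finset.mem_univ, if_true, Fintype.sum_prod_type, Fintype.sum_bool,
      Complex.norm_real, Real.norm_eq_abs, sq_abs, ne_eq, OfNat.ofNat_ne_zero, not_false_eq_true,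
      zero_pow, signOf_true, signOf_false]
    rw [← Finset.sum_add_distrib]
    refine Eq.trans ?_ hc
    refine Finset.sum_congr rfl fun m _ => ?_
    ring
  obtain ⟨V₀, hV₀⟩ := exists_unitary_mulVec_single start _ hφnorm
  -- the permutation that moves the query register to the next index of the branch
  have hmove : ∀ k, ∃ V : Matrix.unitaryGroup (Basis n (ι × Bool)) ℂ, ∀ ψ s,
      (V : Matrix (Basis n (ι × Bool)) (Basis n (ι × Bool)) ℂ).mulVec ψ s
        = ψ (Equiv.swap (e s.2.2.1 s.2.2.2 k) (e s.2.2.1 s.2.2.2 (k + 1)) s.1, s.2) := by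
    intro k
    have hinv : Function.Involutive fun s : Basis n (ι × Bool) =>
        ((Equiv.swap (e s.2.2.1 s.2.2.2 k) (e s.2.2.1 s.2.2.2 (k + 1)) s.1, s.2) :
          Basis n (ι × Bool)) := by
      intro s
      simp
    obtain ⟨V, hV⟩ := exists_unitary_of_sum_norm_sq_eq (LinearMap.funLeft ℂ ℂ hinv.toPerm)
      fun ψ => Equiv.sum_comp hinv.toPerm fun s => ‖ψ s‖ ^ 2
    exact ⟨V, fun ψ s => congrFun (hV ψ) s⟩
  choose V hV using hmove
  -- the Hadamard transform of the branch bit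
  let L : (Basis n (ι × Bool) → ℂ) →ₗ[ℂ] (Basis n (ι × Bool) → ℂ) :=
    { toFun := fun ψ s => ((√2)⁻¹ : ℝ) * (ψ (s.1, s.2.1, s.2.2.1, false)
        + signOf s.2.2.2 * ψ (s.1, s.2.1, s.2.2.1, true))
      map_add' := fun ψ χ => by
        ext s
        simp only [Pi.add_apply]
        ring
      map_smul' := fun r ψ => by
        ext s
        simp only [Pi.smul_apply, smul_eq_mul, RingHom.id_apply]
        ring }
  have hL : ∀ ψ, ∑ s, ‖L ψ s‖ ^ 2 = ∑ s, ‖ψ s‖ ^ 2 := by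
    intro ψ
    simp only [Fintype.sum_prod_type, Fintype.sum_bool, L, LinearMap.coe_mk, AddHom.coe_mk,
      norm_mul, mul_pow, Complex.norm_real, Real.norm_eq_abs, sq_abs, inv_pow,
      Real.sq_sqrt zero_le_two, signOf_true, signOf_false]
    have hpar : ∀ u v : ℂ, (2 : ℝ)⁻¹ * ‖u + ((-1 : ℝ) : ℂ) * v‖ ^ 2
        + 2⁻¹ * ‖u + ((1 : ℝ) : ℂ) * v‖ ^ 2 = ‖v‖ ^ 2 + ‖u‖ ^ 2 := by
      intro u v
      have := parallelogram_law_with_norm ℝ u v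
      simp only [Complex.ofReal_neg, Complex.ofReal_one, neg_mul, one_mul, ← sub_eq_add_neg]
      linarith
    simp only [hpar]
  obtain ⟨H, hH⟩ := exists_unitary_of_sum_norm_sq_eq L hL
  obtain ⟨A, hAT, hAacc, hA⟩ := exists_algorithm_of_evolution T start
    (fun k => Nat.casesOn k V₀ V) H {s | xor s.2.2.2 (neg s.2.2.1) = true} φ
    (fun x => hV₀.trans (hφ0 _ _)) (fun x k => by
      ext ⟨i, b, m, q⟩
      rw [hV]
      have hswap : Equiv.swap (e m q k) (e m q (k + 1)) i = e m q k ↔ i = e m q (k + 1) := by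
        rw [Equiv.swap_apply_eq_iff, Equiv.swap_apply_left]
      simp only [applyOracle, φ, hswap]
      split_ifs with hi
      · rw [hswap.mpr hi, signOf_xor]
        simp only [P, Finset.prod_range_succ]
        push_cast
        ring
      · rfl)
  refine ⟨A, hAT, fun x v => ?_⟩
  have hset : (if v then A.accept else A.acceptᶜ)
      = ({s | s.2.2.2 = xor v (neg s.2.2.1)} : Finset (Basis n (ι × Bool))) := by
    rw [hAacc]
    ext ⟨i, b, m, q⟩
    cases v <;> cases q <;> cases hm : neg m <;> simp [hm]
  have hfinal : ∀ i b m q, ‖A.stateAfter x T (i, b, m, q)‖ ^ 2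
      = if i = none then c m ^ 2 / 4 * (1 + signOf q * (P x m false T * P x m true T)) else 0 := by
    intro i b m q
    rw [hA, hH]
    simp only [L, LinearMap.coe_mk, AddHom.coe_mk, φ, he]
    split_ifs with hi
    · rw [← Complex.ofReal_mul, ← Complex.ofReal_add, ← Complex.ofReal_mul, Complex.norm_real,
        Real.norm_eq_abs, sq_abs, mul_pow, inv_pow, Real.sq_sqrt zero_le_two]
      have h1 := hP x m false T
      have h2 := hP x m true T
      have h3 := signOf_mul_self b
      have h4 := signOf_mul_self q
      linear_combination (c m ^ 2 / 8) * ((P x m false T + signOf q * P x m true T) ^ 2 * h3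
        + h1 + P x m true T ^ 2 * h4 + h2)
    · simp
  rw [Algorithm.outputProb, Algorithm.outcomeProb, hset, hAT, Finset.sum_filter,
    Fintype.sum_prod_type]
  simp only [Fintype.sum_prod_type, hfinal]
  rw [Fintype.sum_eq_single none]
  · rw [Fintype.sum_bool, ← Finset.sum_add_distrib]
    refine Finset.sum_congr rfl fun m _ => ?_
    simp only [if_true, Finset.sum_ite_eq', Finset.mem_univ, signOf_xor, P]
    ring
  · intro i hi
    simp [hi]

/-- Sampling a character `χ_S` with probability proportional to `|a_S|`, and outputting its value
times the sign of `a_S`, favours the sign of `∑ a_S χ_S`. -/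
lemma computableWith_of_signRepresentable {n T : ℕ} {f : BoolFun n}
    (h : SignRepresentable (2 * T) f) : ComputableWith f T := by
  obtain ⟨a, ha⟩ := h
  let ι := {S : Finset (Fin n) // #S ≤ 2 * T}
  have hsub : ∀ g : Finset (Fin n) → ℝ, ∑ S with #S ≤ 2 * T, g S = ∑ S : ι, g S.1 := fun g =>
    Finset.sum_subtype _ (by simp) g
  have hpos : 0 < ∑ S : ι, |a S.1| := by
    refine lt_of_lt_of_le (ha fun _ => false) ?_
    rw [hsub, Finset.mul_sum]
    refine Finset.sum_le_sum fun S _ => (le_abs_self _).trans (le_of_eq ?_)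
    simp [abs_mul, abs_signOf, character]
  choose e he hχ using fun S : ι => exists_query_sequences S.1 S.2
  obtain ⟨A, hAT, hA⟩ := exists_algorithm_outputProb_eq e he
    (fun S => √(|a S.1| / ∑ S : ι, |a S.1|)) (by
      simp only [Real.sq_sqrt (div_nonneg (abs_nonneg _) hpos.le)]
      rw [← Finset.sum_div, div_self hpos.ne']) (fun S => decide (a S.1 < 0))
  refine ⟨ι × Bool, inferInstance, inferInstance, A, hAT, fun x => ?_⟩
  have hx := ha x
  rw [hsub] at hx
  have hsign : ∀ r : ℝ, |r| * signOf (decide (r < 0)) = r := by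
    intro r
    by_cases hr : r < 0
    · simp [hr, abs_of_neg]
    · simp [hr, abs_of_nonneg (not_lt.mp hr)]
  have hprob : A.outputProb x (f x) = 1 / 2
      + (signOf (f x) * ∑ S : ι, a S.1 * character S.1 x) / (2 * ∑ S : ι, |a S.1|) := by
    rw [hA]
    simp only [hχ, Real.sq_sqrt (div_nonneg (abs_nonneg _) hpos.le)]
    have hhalf : (1 : ℝ) / 2 = (∑ S : ι, |a S.1|) / (2 * ∑ S : ι, |a S.1|) := by
      field_simp
    rw [hhalf, ← add_div, Finset.mul_sum, ← Finset.sum_add_distrib, Finset.sum_div]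
    refine Finset.sum_congr rfl fun S _ => ?_
    have := hsign (a S.1)
    field_simp
    linear_combination signOf (f x) * character S.1 x * this
  rw [hprob]
  have : 0 < (signOf (f x) * ∑ S : ι, a S.1 * character S.1 x) / (2 * ∑ S : ι, |a S.1|) := by
    positivity
  linarith

/-! ### Asymptotics -/

/-- With `d` above `n / 2 + 2 √(n log₂ n)`, the fraction of subsets of size exceeding `d` is at most
`1 / n ^ 2`. -/
lemma card_filter_lt_card_le {n d : ℕ} (hn : 0 < n)
    (hd : (n : ℝ) / 2 + 2 * √(n * Real.logb 2 n) ≤ d) :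
    (#{S : Finset (Fin n) | d < #S} : ℝ) ≤ 1 / (n : ℝ) ^ 2 * 2 ^ n := by
  have hn' : (1 : ℝ) ≤ n := by exact_mod_cast hn
  have hlog : Real.log n ≤ Real.logb 2 n := by
    rw [Real.logb, le_div_iff₀ (Real.log_pos one_lt_two)]
    exact mul_le_of_le_one_right (Real.log_nonneg hn') (by linarith [Real.log_two_lt_d9])
  have hL : 0 ≤ Real.logb 2 n := (Real.log_nonneg hn').trans hlog
  have htail := card_finset_filter_le (ι := Fin n) (v := n) (t := 4 * √(n * Real.logb 2 n))
    (e := 1) (by positivity) (by norm_num) (by simp) (by positivity)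
  calc (#{S : Finset (Fin n) | d < #S} : ℝ)
      ≤ 2 ^ n * Real.exp (-((4 * √(n * Real.logb 2 n)) ^ 2 / (2 * n))) := by
        refine le_trans (Nat.cast_le.mpr (Finset.card_le_card fun S hS => ?_))
          (htail.trans (by simp))
        simp only [Finset.mem_filter, Finset.mem_univ, true_and] at hS ⊢
        have hS' : (d : ℝ) ≤ #S := by exact_mod_cast hS.le
        rw [Fintype.card_fin]
        linarith
    _ ≤ 2 ^ n * Real.exp (-(2 * Real.log n)) := by
        have hexp : (4 * √(n * Real.logb 2 n)) ^ 2 / (2 * n) = 8 * Real.logb 2 n := by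
          rw [mul_pow, Real.sq_sqrt (by positivity)]
          field_simp
          ring
        rw [hexp]
        gcongr
        linarith
    _ = _ := by
        rw [Real.exp_neg, two_mul, Real.exp_add, Real.exp_log (by positivity)]
        field_simp

/-- Bounds on the threshold degree give bounds on `UQ f`; the hypothesis `hlow` excludes
`2 * T ≤ n / 2 - 1`, and the case of `n` modulo `4` then decides what `n < 4 * T + 2` yields. -/
lemma UQ_bounds_of_signRepresentable {n : ℕ} (hn : 2 ≤ n) {f : BoolFun n}
    (hup : SignRepresentable (2 * ⌈(n : ℝ) / 4 + √(n * Real.logb 2 n)⌉₊) f)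
    (hlow : ¬ SignRepresentable (n / 2 - 1) f) :
    (n % 4 ≠ 1 → (n : ℝ) / 4 ≤ UQ f) ∧ ((n : ℝ) - 1) / 4 ≤ UQ f ∧
      (UQ f : ℝ) ≤ n / 4 + 2 * √(n * Real.logb 2 n) := by
  have hcomp := computableWith_of_signRepresentable hup
  have hle : UQ f ≤ ⌈(n : ℝ) / 4 + √(n * Real.logb 2 n)⌉₊ := Nat.sInf_le hcomp
  -- the infimum defining `UQ f` is attained, the set of query counts being nonempty
  have hmem : ComputableWith f (UQ f) := Nat.sInf_mem (s := {T | ComputableWith f T}) ⟨_, hcomp⟩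
  have hlt : n < 4 * UQ f + 2 := by
    by_contra! h
    exact hlow ((signRepresentable_of_computableWith hmem).mono (by omega))
  refine ⟨fun hmod => ?_, ?_, ?_⟩
  · have : (n : ℝ) ≤ 4 * UQ f := by exact_mod_cast (by omega : n ≤ 4 * UQ f)
    linarith
  · have : (n : ℝ) ≤ 4 * UQ f + 1 := by exact_mod_cast (by omega : n ≤ 4 * UQ f + 1)
    linarith
  · have hn' : (2 : ℝ) ≤ n := by exact_mod_cast hn
    have hlog : 1 ≤ Real.logb 2 n := by
      rw [Real.le_logb_iff_rpow_le one_lt_two (by linarith)]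
      simpa using hn'
    have hone : 1 ≤ √(n * Real.logb 2 n) := by
      rw [Real.one_le_sqrt]
      nlinarith
    have h1 : (UQ f : ℝ) ≤ ⌈(n : ℝ) / 4 + √(n * Real.logb 2 n)⌉₊ := by exact_mod_cast hle
    have h2 := Nat.ceil_lt_add_one (a := (n : ℝ) / 4 + √(n * Real.logb 2 n)) (by positivity)
    linarith

lemma tendsto_exceptional_fraction :
    Tendsto (fun n : ℕ => 2 ^ (n + 1) * Real.exp (-((n : ℝ) ^ 2 / 2))
      + Real.exp (-(2 ^ n / (2 * ((n : ℝ) + 1) ^ 2)))) atTop (𝓝 0) := by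
  have hfirst : Tendsto (fun n : ℕ => (2 : ℝ) ^ (n + 1) * Real.exp (-((n : ℝ) ^ 2 / 2)))
      atTop (𝓝 0) := by
    have hexp : Tendsto (fun n : ℕ => Real.exp (1 - n)) atTop (𝓝 0) := by
      refine Real.tendsto_exp_atBot.comp ?_
      simpa [sub_eq_add_neg] using
        (tendsto_atBot_add_const_left atTop (1 : ℝ)
          (tendsto_neg_atTop_atBot.comp tendsto_natCast_atTop_atTop))
    refine squeeze_zero' (Eventually.of_forall fun n => by positivity) ?_ hexp
    filter_upwards [eventually_ge_atTop 4] with n hn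
    have hn' : (4 : ℝ) ≤ n := by exact_mod_cast hn
    have h2 : (2 : ℝ) ^ (n + 1) ≤ Real.exp (n + 1) := by
      have : (2 : ℝ) ≤ Real.exp 1 := by linarith [Real.add_one_le_exp (1 : ℝ)]
      calc (2 : ℝ) ^ (n + 1) ≤ Real.exp 1 ^ (n + 1) := by gcongr
        _ = Real.exp (n + 1) := by
          rw [← Real.exp_nat_mul]
          simp
    calc (2 : ℝ) ^ (n + 1) * Real.exp (-((n : ℝ) ^ 2 / 2))
        ≤ Real.exp (n + 1) * Real.exp (-((n : ℝ) ^ 2 / 2)) := by gcongr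
      _ = Real.exp (n + 1 + -((n : ℝ) ^ 2 / 2)) := (Real.exp_add _ _).symm
      _ ≤ Real.exp (1 - n) := Real.exp_le_exp.mpr (by nlinarith)
  have hsecond : Tendsto (fun n : ℕ => Real.exp (-(2 ^ n / (2 * ((n : ℝ) + 1) ^ 2))))
      atTop (𝓝 0) := by
    refine Real.tendsto_exp_atBot.comp (tendsto_neg_atTop_atBot.comp ?_)
    have h0 : Tendsto (fun n : ℕ => (n : ℝ) ^ 2 / 2 ^ n) atTop (𝓝[>] 0) := by
      refine tendsto_nhdsWithin_iff.mpr
        ⟨tendsto_pow_const_div_const_pow_of_one_lt 2 one_lt_two, ?_⟩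
      filter_upwards [eventually_gt_atTop 0] with n hn
      have : (0 : ℝ) < n := by exact_mod_cast hn
      change (0 : ℝ) < (n : ℝ) ^ 2 / 2 ^ n
      positivity
    refine tendsto_atTop_mono' _ ?_
      ((tendsto_inv_nhdsGT_zero.comp h0).const_mul_atTop (by norm_num : (0 : ℝ) < 1 / 8))
    filter_upwards [eventually_ge_atTop 1] with n hn
    have hn' : (1 : ℝ) ≤ n := by exact_mod_cast hn
    simp only [Function.comp_apply, inv_div]
    rw [div_mul_div_comm, one_mul]
    have hle : 2 * ((n : ℝ) + 1) ^ 2 ≤ 8 * (n : ℝ) ^ 2 := by nlinarith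
    exact div_le_div_of_nonneg_left (by positivity) (by positivity) hle
  simpa using hfirst.add hsecond

lemma one_sub_le_proportion {n : ℕ} {P Q R : BoolFun n → Prop} {a b : ℝ}
    (h : ∀ f, ¬ Q f → ¬ R f → P f)
    (hQ : (Nat.card {f // Q f} : ℝ) ≤ a * 2 ^ 2 ^ n)
    (hR : (Nat.card {f // R f} : ℝ) ≤ b * 2 ^ 2 ^ n) : 1 - (a + b) ≤ proportion P := by
  classical
  have hcard : (Nat.card (BoolFun n) : ℝ) = 2 ^ 2 ^ n := by simp [Nat.card_eq_fintype_card]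
  have hunion : Nat.card (BoolFun n)
      ≤ Nat.card {f // P f} + Nat.card {f // Q f} + Nat.card {f // R f} := by
    simp only [Nat.card_eq_fintype_card, Fintype.card_subtype]
    refine le_trans (Finset.card_le_card fun f _ => ?_)
      ((Finset.card_union_le _ _).trans (Nat.add_le_add_right (Finset.card_union_le _ _) _))
    have := h f
    simp only [Finset.mem_union, Finset.mem_filter, Finset.mem_univ, true_and]
    tauto
  have hunion' : (Nat.card (BoolFun n) : ℝ)
      ≤ Nat.card {f // P f} + Nat.card {f // Q f} + Nat.card {f // R f} := by
    exact_mod_cast hunion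
  rw [proportion, hcard, le_div_iff₀ (by positivity)]
  rw [hcard] at hunion'
  linarith

lemma proportion_le_one {n : ℕ} (P : BoolFun n → Prop) : proportion P ≤ 1 :=
  div_le_one_of_le₀ (Nat.cast_le.mpr (Finite.card_subtype_le P)) (Nat.cast_nonneg _)

end QuantumQuery

theorem mainTheorem7 :
    ∃ C : ℝ, 0 < C ∧
      QuantumQuery.ForAlmostEvery fun (n : ℕ) (f : QuantumQuery.BoolFun n) =>
        (n % 4 ≠ 1 → (n : ℝ) / 4 ≤ (QuantumQuery.UQ f : ℝ)) ∧
        ((n : ℝ) - 1) / 4 ≤ (QuantumQuery.UQ f : ℝ) ∧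
        (QuantumQuery.UQ f : ℝ) ≤ (n : ℝ) / 4 + C * Real.sqrt ((n : ℝ) * Real.logb 2 (n : ℝ)) := by
  refine ⟨2, two_pos, ?_⟩
  refine tendsto_of_tendsto_of_tendsto_of_le_of_le'
    (by simpa using tendsto_const_nhds.sub QuantumQuery.tendsto_exceptional_fraction)
    tendsto_const_nhds ?_ (Eventually.of_forall fun n => QuantumQuery.proportion_le_one _)
  filter_upwards [eventually_ge_atTop 2] with n hn
  have hn' : (0 : ℝ) < n := by exact_mod_cast (by omega : 0 < n)
  refine QuantumQuery.one_sub_le_proportion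
    (fun f hup hlow => QuantumQuery.UQ_bounds_of_signRepresentable hn (not_not.mp hup) hlow) ?_ ?_
  · have hd : (n : ℝ) / 2 + 2 * √(n * Real.logb 2 n)
        ≤ (2 * ⌈(n : ℝ) / 4 + √(n * Real.logb 2 n)⌉₊ : ℕ) := by
      push_cast
      linarith [Nat.le_ceil ((n : ℝ) / 4 + √(n * Real.logb 2 n))]
    refine (QuantumQuery.card_not_signRepresentable_le (by positivity)
      (QuantumQuery.card_filter_lt_card_le (by omega) hd)).trans (le_of_eq ?_)
    have hv : 1 / (2 * (1 / (n : ℝ) ^ 2)) = (n : ℝ) ^ 2 / 2 := by field_simp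
    rw [hv]
    ring
  · refine (QuantumQuery.card_signRepresentable_le_exp (by omega)).trans (le_of_eq ?_)
    ring
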